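/- For $k\in\mathbb N=\{1,2,3,\ldots\}$ let $Q_k$ be the $k$-dimensional hypercube: the simple graph whose vertices are the $2^k$ binary strings of length $k$, two strings being adjacent if and only if they differ in exactly one position. For every $k\in\mathbb N$, \[ \min_{(H_1,H_2)}\ \max\bigl(|V(H_1)|,|V(H_2)|\bigr)\;=\;\sum_{\ell=0}^{\lfloor k/2\rfloor}\binom{k}{\ell}+(k\bmod 2)\binom{k-1}{\lfloor k/2\rfloor}, \] where the minimum is taken over all pairs $(H_1,H_2)$ of induced subgraphs of $Q_k$ with $E(H_1)\cup E(H_2)=E(Q_k)$. -/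

import Mathlib

/-- The `k`-dimensional hypercube `Q_k`: the vertices are the binary strings of length `k`, and two
strings are adjacent iff their Hamming distance is `1`. -/
def hypercube (k : ℕ) : SimpleGraph (Fin k → Bool) where
  Adj x y := hammingDist x y = 1
  symm := ⟨fun x y h => by rw [hammingDist_comm]; exact h⟩
  loopless := ⟨fun x h => by simp at h⟩

/-- The pair `H₁`, `H₂` consists of induced subgraphs of `Q_k` that together cover its edges,
`E(H₁) ∪ E(H₂) = E(Q_k)`. -/
def IsInducedEdgeCover (k : ℕ) (H₁ H₂ : (hypercube k).Subgraph) : Prop :=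
  H₁.IsInduced ∧ H₂.IsInduced ∧ H₁.edgeSet ∪ H₂.edgeSet = (hypercube k).edgeSet

/-! If `X` is the set of vertices missed by `H₂`, the covering condition puts every edge at `X` into
`H₁`, so `N[X] ⊆ V(H₁)`. With `a + b = 2 ^ k`, it thus suffices that `|X| > a` forces `|N[X]| ≥ b`.
Here `a` and `b` are the sizes of consecutive Hamming balls for even `k`, and of such balls in
`Q_{k-1}` times an edge for odd `k`. Overlapping sublevel and superlevel sets of the weight
(ignoring one coordinate for odd `k`) attain `b`.

The isoperimetric input is `aboveProfile_closedNbhd`: for nonempty `X` in `Q_{m+1}`, `|N[X]|` is at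
least the piecewise linear function of `|X|` interpolating between the sets "ball times edge". It
follows by induction on the dimension. If the slices along the first coordinate have sizes `x₀ ≥ x₁`
and closed neighbourhoods of sizes `h₀`, `h₁`, then `|N[X]|` is at least `h₀ + h₁` and at least `h₀
+ x₀`. Pascal's rule matches the breakpoints of consecutive dimensions, and the rest is a comparison
of chords. -/

/-! ### Partial sums of binomial coefficients -/

/-- The number of subsets of an `m`-element set with fewer than `j` elements. -/
def binomPrefix (m j : ℕ) : ℕ := ∑ l ∈ Finset.range j, m.choose l

lemma binomPrefix_succ (m j : ℕ) : binomPrefix m (j + 1) = binomPrefix m j + m.choose j :=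
  Finset.sum_range_succ _ _

lemma binomPrefix_zero (m : ℕ) : binomPrefix m 0 = 0 := rfl

lemma binomPrefix_one (m : ℕ) : binomPrefix m 1 = 1 := by simp [binomPrefix]

lemma binomPrefix_two (m : ℕ) : binomPrefix m 2 = m + 1 := by
  simp [binomPrefix, Finset.sum_range_succ]; omega

lemma binomPrefix_mono (m : ℕ) : Monotone (binomPrefix m) :=
  monotone_nat_of_le_succ fun j => by rw [binomPrefix_succ]; omega

lemma one_le_binomPrefix (m j : ℕ) : 1 ≤ binomPrefix m (j + 1) :=
  (binomPrefix_one m).symm.le.trans (binomPrefix_mono m (Nat.le_add_left 1 j))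

lemma binomPrefix_of_lt {m j : ℕ} (h : m < j) : binomPrefix m j = 2 ^ m := by
  obtain ⟨d, rfl⟩ := Nat.exists_eq_add_of_lt h
  clear h
  induction d with
  | zero => exact Nat.sum_range_choose m
  | succ d ih =>
    rw [← add_assoc m d 1, binomPrefix_succ, ih, Nat.choose_eq_zero_of_lt (by omega), add_zero]

lemma binomPrefix_pascal (m j : ℕ) :
    binomPrefix (m + 1) (j + 1) = binomPrefix m (j + 1) + binomPrefix m j := by
  induction j with
  | zero => simp [binomPrefix]
  | succ j ih =>
    rw [binomPrefix_succ (m + 1), ih, Nat.choose_succ_succ, binomPrefix_succ m (j + 1),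
      binomPrefix_succ m j]
    ring

lemma binomPrefix_add_reflect {n i j : ℕ} (h : i + j = n + 1) :
    binomPrefix n i + binomPrefix n j = 2 ^ n := by
  induction i generalizing j with
  | zero => rw [binomPrefix_zero, binomPrefix_of_lt (by omega), zero_add]
  | succ i ih =>
    rw [← ih (show i + (j + 1) = n + 1 by omega), binomPrefix_succ, binomPrefix_succ,
      Nat.choose_symm_of_eq_add (show n = i + j by omega)]
    ring

/-- The increments are consecutive binomial coefficients with quotient `(m - r) / (r + 1)`, the
slope of the `r`-th chord below. -/
lemma binomPrefix_ratio (m r : ℕ) :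
    ((r : ℤ) + 1) * (binomPrefix m (r + 2) - binomPrefix m (r + 1)) =
      (m - r) * (binomPrefix m (r + 1) - binomPrefix m r) := by
  rw [binomPrefix_succ m (r + 1), binomPrefix_succ m r]
  push_cast
  have h := Nat.choose_succ_right_eq m r
  rcases le_or_gt r m with hr | hr
  · zify [hr] at h
    linear_combination h
  · simp [Nat.choose_eq_zero_of_lt hr, Nat.choose_eq_zero_of_lt (hr.trans (Nat.lt_succ_self r))]

/-! ### The isoperimetric profile and its inductive step -/

/-- The chord of the piecewise linear vertex-isoperimetric profile of `Q_{m+1}` whose `r`-th piece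
joins `(2b_r, 2b_{r+1})` to `(2b_{r+1}, 2b_{r+2})`, where `b_j = binomPrefix m j`. -/
def AboveChord (m r : ℕ) (x h : ℤ) : Prop :=
  ((m : ℤ) - r) * (x - 2 * binomPrefix m (r + 1)) ≤ (r + 1) * (h - 2 * binomPrefix m (r + 2))

/-- `h` lies on or above the isoperimetric profile of `Q_{m+1}` at `x`. -/
def AboveProfile (m : ℕ) (x h : ℤ) : Prop :=
  ∀ r : ℕ, 2 * (binomPrefix m r : ℤ) ≤ x → x ≤ 2 * binomPrefix m (r + 1) → AboveChord m r x h

/-- The first piece: either `x₁ = 0`, or `x₀ = x₁ = 1`. The profile has value 2 at 0, so it says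
nothing true about an empty slice; hence the guard `1 ≤ x₁`. -/
lemma aboveChord_succ_zero {m : ℕ} {x₀ x₁ h₀ h₁ N : ℤ} (h₁₀ : x₁ ≤ x₀) (hx₁ : 0 ≤ x₁)
    (hx₀ : 1 ≤ x₀) (H₀ : AboveProfile m x₀ h₀) (H₁ : 1 ≤ x₁ → AboveProfile m x₁ h₁)
    (hN : h₀ + h₁ ≤ N) (hN' : h₀ + x₀ ≤ N) (hs : x₀ + x₁ ≤ 2) :
    AboveChord (m + 1) 0 (x₀ + x₁) N := by
  have e₀ := H₀ 0 (by simp [binomPrefix]; omega) (by simp [binomPrefix]; omega)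
  unfold AboveChord at *
  simp only [zero_add, binomPrefix_one, binomPrefix_two] at *
  push_cast at *
  rcases hx₁.eq_or_lt with rfl | hx₁
  · linarith
  · have e₁ := H₁ (by omega) 0 (by simp [binomPrefix]; omega) (by simp [binomPrefix]; omega)
    unfold AboveChord at e₁
    simp only [zero_add, binomPrefix_one, binomPrefix_two] at e₁
    push_cast at e₁
    obtain rfl : x₀ = 1 := by omega
    obtain rfl : x₁ = 1 := by omega
    linarith

lemma aboveChord_succ_succ {m q : ℕ} {x₀ x₁ h₀ h₁ N : ℤ} (h₁₀ : x₁ ≤ x₀) (hx₁ : 0 ≤ x₁)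
    (H₀ : AboveProfile m x₀ h₀) (H₁ : 1 ≤ x₁ → AboveProfile m x₁ h₁)
    (Hm : ∀ r, 2 * (binomPrefix m (r + 1) : ℤ) ≤ x₀ → 2 * (binomPrefix m (r + 2) : ℤ) ≤ h₀)
    (hN : h₀ + h₁ ≤ N) (hN' : h₀ + x₀ ≤ N)
    (hs : 2 * (binomPrefix (m + 1) (q + 1) : ℤ) ≤ x₀ + x₁)
    (hs' : x₀ + x₁ ≤ 2 * binomPrefix (m + 1) (q + 2)) :
    AboveChord (m + 1) (q + 1) (x₀ + x₁) N := by
  have r₀ := binomPrefix_ratio m q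
  have r₁ := binomPrefix_ratio m (q + 1)
  have hmono := binomPrefix_mono m
  have m₀ : (binomPrefix m q : ℤ) ≤ binomPrefix m (q + 1) := by exact_mod_cast hmono (by omega)
  have b₀ : 0 ≤ (binomPrefix m q : ℤ) := by positivity
  have b₁ : 1 ≤ (binomPrefix m (q + 1) : ℤ) := by exact_mod_cast one_le_binomPrefix m q
  have E₀ := H₀ q
  have E₀' := H₀ (q + 1)
  have E₁ := fun h => H₁ h q
  have E₁' := fun h => H₁ h (q + 1)
  have M := Hm (q + 1)
  have hb : m < q → (binomPrefix m q : ℤ) = binomPrefix m (q + 1) := fun h => by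
    rw [binomPrefix_of_lt h, binomPrefix_of_lt (by omega)]
  have hb' : m < q → (binomPrefix m (q + 1) : ℤ) = binomPrefix m (q + 1 + 1) := fun h => by
    rw [binomPrefix_of_lt (by omega), binomPrefix_of_lt (by omega)]
  unfold AboveChord at *
  rw [binomPrefix_pascal] at hs
  rw [binomPrefix_pascal m (q + 1)] at hs'
  rw [binomPrefix_pascal m (q + 1), binomPrefix_pascal m (q + 1 + 1)]
  clear H₀ H₁ Hm
  simp only [add_assoc, Nat.reduceAdd] at *
  push_cast at *
  generalize (binomPrefix m q : ℤ) = P₀ at *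
  generalize (binomPrefix m (q + 1) : ℤ) = P₁ at *
  generalize (binomPrefix m (q + 2) : ℤ) = P₂ at *
  generalize (binomPrefix m (q + 3) : ℤ) = P₃ at *
  have hq : (0 : ℤ) ≤ q := by positivity
  have hqN : (0 : ℤ) ≤ (q + 1) * (N - h₀ - h₁) := mul_nonneg (by omega) (by omega)
  have hqN' : (0 : ℤ) ≤ (q + 1) * (N - h₀ - x₀) := mul_nonneg (by omega) (by omega)
  -- A large slice alone reaches the value `2 * (P₃ + P₂)` at the right end of the piece, through
  -- `h₀ + x₀`.
  by_cases c₁ : 2 * P₂ ≤ x₀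
  · have : (0 : ℤ) ≤ (q + 2) * (N - 2 * (P₃ + P₂)) := mul_nonneg (by omega) (by linarith [M c₁])
    rcases le_or_gt q m with h | h
    · have : 0 ≤ ((m : ℤ) - q) * (2 * (P₂ + P₁) - (x₀ + x₁)) := mul_nonneg (by omega) (by omega)
      linarith
    · have : x₀ + x₁ = 2 * (P₂ + P₁) := by linarith [hb h, hb' h]
      rw [this]
      linarith
  -- For `m < q` all `Pᵢ` involved agree, and `x₁ ≤ x₀ < 2 * P₂` contradicts the lower bound on `x₀
  -- + x₁`.
  rcases lt_or_ge m q with h | h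
  · linarith [hb h, hb' h]
  have hmq : (0 : ℤ) ≤ m - q := by omega
  by_cases c₂ : 2 * P₁ ≤ x₀
  · have e₀ := E₀' c₂ (by omega)
    -- For small `x₁` the bound `h₀ + x₀` alone suffices.
    by_cases c₃ : x₁ ≤ 2 * P₀
    · have : 0 ≤ ((m : ℤ) - q) * (2 * P₀ - x₁) := mul_nonneg hmq (by omega)
      have : 0 ≤ ((q : ℤ) + 1) * (x₀ - 2 * P₁) := mul_nonneg (by omega) (by omega)
      linarith
    · by_cases c₄ : x₁ ≤ 2 * P₁
      -- The slices lie on adjacent pieces, with denominators `q + 2` and `q + 1`. The mismatch `h₁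
      -- - x₀` is absorbed by giving `h₀ + h₁ ≤ N` weight `q + 1` and `h₀ + x₀ ≤ N` weight 1.
      · linarith [E₁ (by omega) (by omega) c₄]
      · linarith [E₁' (by omega) (by omega) (by omega)]
  -- Now both slices lie on piece `q`. Its chord is at least as steep as the target and agrees with
  -- it at the left endpoint; the factor `q + 1` clears denominators.
  · have e₀ := E₀ (by omega) (by omega)
    have e₁ := E₁ (by omega) (by omega) (by omega)
    have : 0 ≤ ((m : ℤ) - q) * (x₀ + x₁ - 2 * (P₁ + P₀)) := mul_nonneg hmq (by omega)
    refine le_of_mul_le_mul_left ?_ (show (0 : ℤ) < q + 1 by omega)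
    have k₁ := mul_le_mul_of_nonneg_left (add_le_add e₀ e₁) (show (0 : ℤ) ≤ q + 2 by omega)
    have k₂ := mul_nonneg (show (0 : ℤ) ≤ q + 2 by omega) hqN
    have k₃ := congrArg (fun z => ((q : ℤ) + 1) * z) r₁
    have k₄ := congrArg (fun z => ((m : ℤ) - q) * z) r₀
    beta_reduce at k₃ k₄
    linarith

/-! ### Closed neighbourhoods, slices and the isoperimetric inequality -/

open Finset in
/-- The vertices of the cube at distance at most one from `X`. -/
def closedNbhd {n : ℕ} (X : Finset (Fin n → Bool)) : Finset (Fin n → Bool) :=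
  univ.filter fun y => ∃ x ∈ X, hammingDist x y ≤ 1

/-- The vertices of `X` with first coordinate `c`, with this coordinate deleted. -/
def cubeSlice {n : ℕ} (c : Bool) (X : Finset (Fin (n + 1) → Bool)) : Finset (Fin n → Bool) :=
  Finset.univ.filter fun y => (Fin.cons c y : Fin (n + 1) → Bool) ∈ X

lemma mem_closedNbhd {n : ℕ} {X : Finset (Fin n → Bool)} {y : Fin n → Bool} :
    y ∈ closedNbhd X ↔ ∃ x ∈ X, hammingDist x y ≤ 1 := by simp [closedNbhd]

lemma mem_cubeSlice {n : ℕ} {c : Bool} {X : Finset (Fin (n + 1) → Bool)} {y : Fin n → Bool} :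
    y ∈ cubeSlice c X ↔ (Fin.cons c y : Fin (n + 1) → Bool) ∈ X := by simp [cubeSlice]

lemma closedNbhd_mono {n : ℕ} {X Y : Finset (Fin n → Bool)} (h : X ⊆ Y) :
    closedNbhd X ⊆ closedNbhd Y := fun y hy => by
  obtain ⟨x, hx, hxy⟩ := mem_closedNbhd.1 hy
  exact mem_closedNbhd.2 ⟨x, h hx, hxy⟩

lemma hammingDist_cons {n : ℕ} (a b : Bool) (x y : Fin n → Bool) :
    hammingDist (Fin.cons a x : Fin (n + 1) → Bool) (Fin.cons b y) =
      (if a ≠ b then 1 else 0) + hammingDist x y := by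
  simp only [hammingDist, Finset.card_filter, Fin.sum_univ_succ, Fin.cons_zero, Fin.cons_succ]

lemma card_cubeSlice_add {n : ℕ} (c : Bool) (X : Finset (Fin (n + 1) → Bool)) :
    (cubeSlice c X).card + (cubeSlice (!c) X).card = X.card := by
  have key : ∀ c, (cubeSlice c X).card = (X.filter fun x => x 0 = c).card := fun c => by
    refine Finset.card_bij (fun y _ => (Fin.cons c y : Fin (n + 1) → Bool)) ?_ ?_ ?_
    · intro y hy
      simpa using mem_cubeSlice.1 hy
    · intro y _ z _ h
      exact (Fin.cons_inj.1 h).2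
    · intro x hx
      obtain ⟨hx, rfl⟩ := Finset.mem_filter.1 hx
      exact ⟨Fin.tail x, mem_cubeSlice.2 (by rwa [Fin.cons_self_tail]), Fin.cons_self_tail x⟩
  rw [key, key, ← Finset.card_filter_add_card_filter_not (s := X) (fun x => x 0 = c)]
  congr 2
  ext x
  simp only [Finset.mem_filter, and_congr_right_iff]
  intro _
  cases x 0 <;> cases c <;> simp

lemma closedNbhd_cubeSlice_subset {n : ℕ} (c : Bool) (X : Finset (Fin (n + 1) → Bool)) :
    closedNbhd (cubeSlice c X) ⊆ cubeSlice c (closedNbhd X) := fun y hy => by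
  obtain ⟨x, hx, hxy⟩ := mem_closedNbhd.1 hy
  exact mem_cubeSlice.2 (mem_closedNbhd.2 ⟨_, mem_cubeSlice.1 hx, by simpa [hammingDist_cons]⟩)

lemma cubeSlice_subset_closedNbhd {n : ℕ} (c : Bool) (X : Finset (Fin (n + 1) → Bool)) :
    cubeSlice c X ⊆ cubeSlice (!c) (closedNbhd X) := fun y hy =>
  mem_cubeSlice.2 (mem_closedNbhd.2 ⟨_, mem_cubeSlice.1 hy, by simp [hammingDist_cons]⟩)

lemma card_closedNbhd_cubeSlice_add_le {n : ℕ} (c : Bool) (X : Finset (Fin (n + 1) → Bool)) :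
    (closedNbhd (cubeSlice c X)).card + (closedNbhd (cubeSlice (!c) X)).card ≤
      (closedNbhd X).card := by
  rw [← card_cubeSlice_add c (closedNbhd X)]
  exact add_le_add (Finset.card_le_card (closedNbhd_cubeSlice_subset _ _))
    (Finset.card_le_card (closedNbhd_cubeSlice_subset _ _))

lemma card_closedNbhd_cubeSlice_add_card_le {n : ℕ} (c : Bool)
    (X : Finset (Fin (n + 1) → Bool)) :
    (closedNbhd (cubeSlice c X)).card + (cubeSlice c X).card ≤ (closedNbhd X).card := by
  rw [← card_cubeSlice_add c (closedNbhd X)]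
  exact add_le_add (Finset.card_le_card (closedNbhd_cubeSlice_subset _ _))
    (Finset.card_le_card (cubeSlice_subset_closedNbhd _ _))

/-- If the isoperimetric inequality holds in `Q_{m+1}`, then a set with at least `2b_{r+1}` elements
has at least `2b_{r+2}` elements in its closed neighbourhood. -/
lemma le_card_closedNbhd_of_aboveProfile {m : ℕ}
    (H : ∀ X : Finset (Fin (m + 1) → Bool), X.Nonempty →
      AboveProfile m X.card (closedNbhd X).card)
    {X : Finset (Fin (m + 1) → Bool)} {r : ℕ} (h : 2 * binomPrefix m (r + 1) ≤ X.card) :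
    2 * binomPrefix m (r + 2) ≤ (closedNbhd X).card := by
  -- A subset of size exactly `2b_{r+1}` sits at the right end of piece `r`, which avoids proving
  -- the profile monotone.
  obtain ⟨Y, hYX, hY⟩ := Finset.exists_subset_card_eq h
  have hb := one_le_binomPrefix m r
  have hmono : binomPrefix m r ≤ binomPrefix m (r + 1) := binomPrefix_mono m (by omega)
  have := H Y (Finset.card_pos.1 (by omega)) r (by rw [hY]; push_cast; omega)
    (by rw [hY]; push_cast; rfl)
  unfold AboveChord at this
  rw [hY] at this
  push_cast at this
  rw [sub_self, mul_zero] at this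
  have h₂ := nonneg_of_mul_nonneg_right this (by positivity)
  have := Finset.card_le_card (closedNbhd_mono hYX)
  omega

/-- A vertex-isoperimetric inequality in the cube. -/
theorem aboveProfile_closedNbhd (m : ℕ) (X : Finset (Fin (m + 1) → Bool)) (hX : X.Nonempty) :
    AboveProfile m X.card (closedNbhd X).card := by
  induction m with
  | zero =>
    have hN : (closedNbhd X).card = 2 := by
      obtain ⟨x, hx⟩ := hX
      have : closedNbhd X = Finset.univ := by
        refine Finset.eq_univ_of_forall fun y => mem_closedNbhd.2 ⟨x, hx, ?_⟩
        simpa using hammingDist_le_card_fintype (x := x) (y := y)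
      rw [this]
      simp
    intro r h₁ h₂
    unfold AboveChord
    rw [hN, binomPrefix_of_lt (by omega : 0 < r + 1), binomPrefix_of_lt (by omega : 0 < r + 2)]
    rw [binomPrefix_of_lt (by omega : 0 < r + 1)] at h₂
    rcases r.eq_zero_or_pos with rfl | hr
    · simp
    · rw [binomPrefix_of_lt hr] at h₁
      have : (X.card : ℤ) = 2 := by push_cast at h₁ h₂; omega
      simp [this]
  | succ m ih =>
    intro r h₁ h₂
    obtain ⟨c, hc⟩ : ∃ c, (cubeSlice (!c) X).card ≤ (cubeSlice c X).card := by
      rcases le_total (cubeSlice true X).card (cubeSlice false X).card with h | h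
      · exact ⟨false, h⟩
      · exact ⟨true, h⟩
    have hs := card_cubeSlice_add c X
    have hpos := Finset.card_pos.2 hX
    have e : (X.card : ℤ) = (cubeSlice c X).card + (cubeSlice (!c) X).card := by
      exact_mod_cast hs.symm
    have H₀ := ih (cubeSlice c X) (Finset.card_pos.1 (by omega))
    have H₁ : (1 : ℤ) ≤ (cubeSlice (!c) X).card → _ := fun h =>
      ih (cubeSlice (!c) X) (Finset.card_pos.1 (by omega))
    have hN : ((closedNbhd (cubeSlice c X)).card : ℤ) + (closedNbhd (cubeSlice (!c) X)).card ≤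
      (closedNbhd X).card := by exact_mod_cast card_closedNbhd_cubeSlice_add_le c X
    have hN' : ((closedNbhd (cubeSlice c X)).card : ℤ) + (cubeSlice c X).card ≤
      (closedNbhd X).card := by exact_mod_cast card_closedNbhd_cubeSlice_add_card_le c X
    rw [e] at h₁ h₂ ⊢
    cases r with
    | zero =>
      refine aboveChord_succ_zero (by omega) (by omega) (by omega) H₀ H₁ hN hN' ?_
      rw [zero_add, binomPrefix_one] at h₂
      simpa using h₂
    | succ q =>
      refine aboveChord_succ_succ (by omega) (by omega) H₀ H₁ (fun r hr => ?_) hN hN' h₁ h₂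
      exact_mod_cast le_card_closedNbhd_of_aboveProfile ih (r := r) (by exact_mod_cast hr)

lemma two_mul_binomPrefix_le_card_closedNbhd {m r : ℕ} {X : Finset (Fin (m + 1) → Bool)}
    (h : 2 * binomPrefix m (r + 1) ≤ X.card) :
    2 * binomPrefix m (r + 2) ≤ (closedNbhd X).card :=
  le_card_closedNbhd_of_aboveProfile (aboveProfile_closedNbhd m) h

/-- Sets at least as large as a Hamming ball have a closed neighbourhood at least as large as
the next ball; stated at the middle radius of an even-dimensional cube. -/
lemma binomPrefix_le_card_closedNbhd {m t : ℕ} (hm : m = 2 * t + 1)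
    {X : Finset (Fin (m + 1) → Bool)} (h : binomPrefix (m + 1) (t + 1) ≤ X.card) :
    binomPrefix (m + 1) (t + 2) ≤ (closedNbhd X).card := by
  obtain ⟨Y, hYX, hY⟩ := Finset.exists_subset_card_eq h
  have hb := one_le_binomPrefix (m + 1) t
  have hp := binomPrefix_pascal m t
  have hp' : binomPrefix (m + 1) (t + 2) = binomPrefix m (t + 2) + binomPrefix m (t + 1) :=
    binomPrefix_pascal m (t + 1)
  have hmono : binomPrefix m t ≤ binomPrefix m (t + 1) := binomPrefix_mono m (by omega)
  -- By Pascal's rule `|Y|` is the midpoint of `2b_t` and `2b_{t+1}`, and `m = 2t + 1` makes the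
  -- slope of this piece 1.
  have H := aboveProfile_closedNbhd m Y (Finset.card_pos.1 (by omega)) t
    (by rw [hY, hp]; push_cast; omega) (by rw [hY, hp]; push_cast; omega)
  have hr := binomPrefix_ratio m t
  unfold AboveChord at H
  have hmt : (m : ℤ) - t = t + 1 := by rw [hm]; push_cast; ring
  rw [hY, hp, hmt] at H
  rw [hmt] at hr
  have h₂ := le_of_mul_le_mul_left H (by positivity)
  have h₃ := mul_left_cancel₀ (by positivity) hr
  have := Finset.card_le_card (closedNbhd_mono hYX)
  push_cast at *
  rw [hp']
  omega

/-! ### Sizes of level sets -/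

lemma card_hammingDist_false_lt (n j : ℕ) :
    (Finset.univ.filter fun x : Fin n → Bool => hammingDist (fun _ => false) x < j).card =
      binomPrefix n j := by
  induction n generalizing j with
  | zero =>
    cases j with
    | zero => simp [binomPrefix]
    | succ j => simp [binomPrefix_of_lt, hammingDist]
  | succ n ih =>
    have hc : (fun _ : Fin (n + 1) => false) = Fin.cons false fun _ => false := by
      ext i
      cases i using Fin.cases <;> rfl
    cases j with
    | zero => simp [binomPrefix]
    | succ j =>
      rw [binomPrefix_pascal, ← ih (j + 1), ← ih j, ← card_cubeSlice_add false]
      simp only [cubeSlice, Finset.mem_filter, Finset.mem_univ, true_and, hc, hammingDist_cons]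
      congr 3 <;> ext x <;> (simp; try omega)

lemma card_filter_tail {n : ℕ} (p : (Fin n → Bool) → Prop) [DecidablePred p] :
    (Finset.univ.filter fun x : Fin (n + 1) → Bool => p (Fin.tail x)).card =
      2 * (Finset.univ.filter p).card := by
  rw [← card_cubeSlice_add false, two_mul]
  simp [cubeSlice]

lemma card_not_lt {n j : ℕ} {v : (Fin n → Bool) → ℕ} {a b : ℕ} (hab : a + b = 2 ^ n)
    (h : (Finset.univ.filter fun x => v x < j).card = a) :
    (Finset.univ.filter fun x => j ≤ v x).card = b := by
  have := Finset.card_filter_add_card_filter_not (s := Finset.univ) (fun x => v x < j)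
  simp only [not_lt, Finset.card_univ, Fintype.card_fun, Fintype.card_bool, Fintype.card_fin] at this
  omega

lemma hammingDist_tail_le {n : ℕ} (x y : Fin (n + 1) → Bool) :
    hammingDist (Fin.tail x) (Fin.tail y) ≤ hammingDist x y := by
  conv_rhs => rw [← Fin.cons_self_tail x, ← Fin.cons_self_tail y, hammingDist_cons]
  omega

/-! ### Edge covers and the extremal value -/

/-- The sublevel and superlevel sets of a function on the cube that changes by at most one along
each edge induce an edge cover. -/
lemma isInducedEdgeCover_induce {k : ℕ} (t : ℕ) (v : (Fin k → Bool) → ℕ)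
    (hv : ∀ x y, v y ≤ v x + hammingDist x y) :
    IsInducedEdgeCover k ((⊤ : (hypercube k).Subgraph).induce {x | v x < t + 1})
      ((⊤ : (hypercube k).Subgraph).induce {x | t ≤ v x}) := by
  refine ⟨fun x hx y hy h => ⟨hx, hy, h⟩, fun x hx y hy h => ⟨hx, hy, h⟩, ?_⟩
  ext e
  induction e using Sym2.ind with
  | _ x y =>
    simp only [Set.mem_union, SimpleGraph.Subgraph.mem_edgeSet, SimpleGraph.mem_edgeSet,
      SimpleGraph.Subgraph.induce_adj, SimpleGraph.Subgraph.top_adj, Set.mem_ofPred_eq]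
    refine ⟨by tauto, fun h => ?_⟩
    have h₁ := hv x y
    have h₂ := hv y x
    rw [hammingDist_comm] at h₂
    have h' : hammingDist x y = 1 := h
    rw [h'] at h₁ h₂
    rcases lt_or_ge (v x) (t + 1) with hx | hx <;> rcases lt_or_ge (v y) (t + 1) with hy | hy
    · exact Or.inl ⟨hx, hy, h⟩
    all_goals exact Or.inr ⟨by omega, by omega, h⟩

/-- In an edge cover by two induced subgraphs, the closed neighbourhood of the vertices missed by
the second one lies in the first one. -/
lemma closedNbhd_subset_of_isInducedEdgeCover {k : ℕ} (hk : 1 ≤ k) {H₁ H₂ : (hypercube k).Subgraph}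
    (h : IsInducedEdgeCover k H₁ H₂) {X : Finset (Fin k → Bool)} (hX : ∀ x ∈ X, x ∉ H₂.verts) :
    (closedNbhd X : Set (Fin k → Bool)) ⊆ H₁.verts := by
  have key : ∀ x ∈ X, ∀ y, (hypercube k).Adj x y → H₁.Adj x y := fun x hx y hxy => by
    have : s(x, y) ∈ H₁.edgeSet ∪ H₂.edgeSet := by
      rw [h.2.2]
      exact hxy
    rcases this with h' | h'
    · exact h'
    · exact absurd (H₂.edge_vert h') (hX x hx)
  intro y hy
  obtain ⟨x, hx, hxy⟩ := mem_closedNbhd.1 hy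
  rcases Nat.le_one_iff_eq_zero_or_eq_one.1 hxy with h0 | h1
  · obtain rfl := hammingDist_eq_zero.1 h0
    -- A vertex of `X` lies in `H₁` because some edge leaves it; this is where `k ≥ 1` enters.
    let i : Fin k := ⟨0, hk⟩
    refine H₁.edge_vert (key x hx (Function.update x i (!x i)) ?_)
    change hammingDist _ _ = 1
    rw [hammingDist, Finset.card_eq_one]
    refine ⟨i, ?_⟩
    ext j
    by_cases hj : j = i
    · subst hj
      simp
    · simp [hj]
  · exact H₁.edge_vert (key x hx y h1).symm

lemma le_max_ncard_of_isInducedEdgeCover {k : ℕ} (hk : 1 ≤ k) {H₁ H₂ : (hypercube k).Subgraph}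
    (h : IsInducedEdgeCover k H₁ H₂) {a b : ℕ} (hab : a + b = 2 ^ k)
    (hX : ∀ X : Finset (Fin k → Bool), a + 1 ≤ X.card → b ≤ (closedNbhd X).card) :
    b ≤ max H₁.verts.ncard H₂.verts.ncard := by
  by_contra! hlt
  rw [max_lt_iff] at hlt
  have hc := Set.ncard_add_ncard_compl H₂.verts
  rw [Nat.card_eq_fintype_card, Fintype.card_fun, Fintype.card_bool, Fintype.card_fin] at hc
  classical
  have hN := hX H₂.vertsᶜ.toFinset (by rw [← Set.ncard_eq_toFinset_card']; omega)
  have := Set.ncard_le_ncard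
    (closedNbhd_subset_of_isInducedEdgeCover hk h (X := H₂.vertsᶜ.toFinset) (by simp))
  rw [Set.ncard_coe_finset] at this
  omega

lemma binomPrefix_odd_le_card_closedNbhd (t : ℕ) {X : Finset (Fin (2 * t + 1) → Bool)}
    (h : 2 * binomPrefix (2 * t) t + 1 ≤ X.card) :
    2 * binomPrefix (2 * t) (t + 1) ≤ (closedNbhd X).card := by
  cases t with
  | succ t => exact two_mul_binomPrefix_le_card_closedNbhd (by omega)
  -- In `Q_1` the threshold is 0 and the empty set must be excluded: only here is the `+ 1` in `h`
  -- needed.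
  | zero =>
    change Finset (Fin 1 → Bool) at X
    simp only [mul_zero, zero_add, binomPrefix_zero, binomPrefix_one, mul_one] at h ⊢
    have hc := X.card_le_univ
    rw [Fintype.card_fun, Fintype.card_bool, Fintype.card_fin, pow_one] at hc
    have H := aboveProfile_closedNbhd 0 X (Finset.card_pos.1 h) 0
      (by simp [binomPrefix]) (by simpa [binomPrefix] using hc)
    simpa [AboveChord, binomPrefix_one, binomPrefix_two] using H

theorem theorem4p1 (k : ℕ) (hk : 1 ≤ k) :
    IsLeast
      {n : ℕ | ∃ H₁ H₂ : (hypercube k).Subgraph, IsInducedEdgeCover k H₁ H₂ ∧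
        n = max H₁.verts.ncard H₂.verts.ncard}
      ((∑ ℓ ∈ Finset.range (k / 2 + 1), k.choose ℓ) + (k % 2) * (k - 1).choose (k / 2)) := by
  change IsLeast _ (binomPrefix k (k / 2 + 1) + _)
  -- The cover is `{v < t + 1}` and `{t ≤ v}`; both have `b` elements since `a + b = 2 ^ k`.
  suffices H : ∃ (t a b : ℕ) (v : (Fin k → Bool) → ℕ), a + b = 2 ^ k ∧
      binomPrefix k (k / 2 + 1) + (k % 2) * (k - 1).choose (k / 2) = b ∧
      (∀ x y, v y ≤ v x + hammingDist x y) ∧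
      (Finset.univ.filter fun x => v x < t).card = a ∧
      (Finset.univ.filter fun x => v x < t + 1).card = b ∧
      ∀ X : Finset (Fin k → Bool), a + 1 ≤ X.card → b ≤ (closedNbhd X).card by
    obtain ⟨t, a, b, v, hab, e, hv, ha, hb, hX⟩ := H
    rw [e]
    refine ⟨⟨_, _, isInducedEdgeCover_induce t v hv, ?_⟩, ?_⟩
    · have hb' := card_not_lt hab ha
      rw [← Set.ncard_coe_finset] at hb hb'
      simp only [Finset.coe_filter, Finset.mem_univ, true_and] at hb hb'
      simp only [SimpleGraph.Subgraph.induce_verts, hb, hb', max_self]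
    · rintro n ⟨H₁, H₂, h, rfl⟩
      exact le_max_ncard_of_isInducedEdgeCover hk h hab hX
  obtain ⟨t, rfl | rfl⟩ := Nat.even_or_odd' k
  · refine ⟨t, _, _, hammingDist fun _ => false, binomPrefix_add_reflect (by omega), by simp,
      fun x y => hammingDist_triangle _ _ _, card_hammingDist_false_lt _ _,
      card_hammingDist_false_lt _ _, ?_⟩
    obtain ⟨t, rfl⟩ : ∃ s, t = s + 1 := ⟨t - 1, by omega⟩
    exact fun X hX => binomPrefix_le_card_closedNbhd (m := 2 * t + 1) rfl (Nat.le_of_succ_le hX)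
  -- For odd `k`, `v` is the weight without the first coordinate, so its level sets are balls in
  -- `Q_{2t}` and their complements, times an edge.
  · refine ⟨t, 2 * binomPrefix (2 * t) t, 2 * binomPrefix (2 * t) (t + 1),
      fun x => hammingDist (fun _ => false) (Fin.tail x), ?_, ?_,
      fun x y => (hammingDist_triangle _ _ _).trans
        (Nat.add_le_add_left (hammingDist_tail_le x y) _), ?_, ?_,
      fun X hX => binomPrefix_odd_le_card_closedNbhd t hX⟩
    · rw [← mul_add, binomPrefix_add_reflect (by omega), pow_succ, mul_comm]
    · rw [show (2 * t + 1) / 2 = t by omega, show (2 * t + 1) % 2 = 1 by omega, Nat.add_sub_cancel,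
        binomPrefix_pascal, binomPrefix_succ]
      ring
    · rw [card_filter_tail fun x => hammingDist (fun _ => false) x < t, card_hammingDist_false_lt]
    · rw [card_filter_tail fun x => hammingDist (fun _ => false) x < t + 1,
        card_hammingDist_false_lt]
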